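/- Write $\mathbb{R}_+ = \left]0,\infty\right[$. A function $f:\mathbb{R}_+\to\mathbb{R}$ is *completely monotone* (CM) if it is infinitely differentiable and $(-1)^n f^{(n)}(y) \ge 0$ for all $y>0$ and all integers $n \ge 0$. It is a *Bernstein function* if it is non-negative and differentiable and its derivative is CM. It is a *complete Bernstein function* (CBF) if there is a Bernstein function $g$ such that $f(y) = y^2\int_0^\infty e^{-yt} g(t)\,dt$ for all $y>0$. **Lemma.** Let $Q$ be a CBF that is not identically zero on $\mathbb{R}_+$, and let $\alpha>0$ be a real number. Then $Q(p)>0$ for every $p>0$, and the function $p\mapsto Q(p)^{-\alpha}$ is completely monotone on $\mathbb{R}_+$. -/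

import Mathlib

open Set MeasureTheory
open scoped ContDiff

/-- A function on `]0, ∞[` is completely monotone if it is infinitely differentiable and
`(-1)^n D^n f ≥ 0` on `]0, ∞[` for every `n ≥ 0`. Only the values on `]0, ∞[` matter. -/
def IsCompletelyMonotone (f : ℝ → ℝ) : Prop :=
  ContDiffOn ℝ ∞ f (Ioi 0) ∧
    ∀ (n : ℕ) (y : ℝ), 0 < y → 0 ≤ (-1 : ℝ) ^ n * iteratedDeriv n f y

/-- A function on `]0, ∞[` is a Bernstein function if it is non-negative, differentiable, and
its derivative is completely monotone. -/
def IsBernstein (f : ℝ → ℝ) : Prop :=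
  (∀ y : ℝ, 0 < y → 0 ≤ f y) ∧ DifferentiableOn ℝ f (Ioi 0) ∧ IsCompletelyMonotone (deriv f)

/-- The (one-sided) Laplace transform `∫₀^∞ e^{-y t} g(t) dt` at a real argument `y`. -/
noncomputable def laplaceReal (g : ℝ → ℝ) (y : ℝ) : ℝ :=
  ∫ t in Ioi (0 : ℝ), Real.exp (-(y * t)) * g t

/-- A function `f` on `]0, ∞[` is a complete Bernstein function if `f(y) = y² g̃(y)` for all
`y > 0`, for some Bernstein function `g` with Laplace transform `g̃`. The integral always
converges: a Bernstein function is bounded near `0` and grows at most linearly. -/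
def IsCompleteBernstein (f : ℝ → ℝ) : Prop :=
  ∃ g : ℝ → ℝ, IsBernstein g ∧ ∀ y : ℝ, 0 < y → f y = y ^ 2 * laplaceReal g y

/-!
A complete Bernstein function is a Bernstein function, and a negative power of a positive
Bernstein function is completely monotone.

For the first fact, write `f(y) = y² ∫₀^∞ e^{-y t} g(t) dt` with `g` a Bernstein function. The
function `y² e^{-y t}` is the second `t`-derivative of `e^{-y t}`, so for `n ≥ 1`
differentiation under the integral sign gives `(-1)ⁿ f⁽ⁿ⁾(y) = ∫₀^∞ φ''(t) g(t) dt` with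
`φ(t) = tⁿ e^{-y t}` (`IsBernstein.iteratedDeriv_sq_mul_laplaceReal`; the interchange is taken
from the theory of moment generating functions, applied to the measure `g(t) dt`). Formally, this
integral is at most `∫₀^∞ φ(t) g''(t) dt ≤ 0`, because `g` is concave. The boundary term
`φ' g - φ g'` is non-positive near infinity, and near `0` the inequality `t g'(t) ≤ g(t)`
(`IsBernstein.mul_deriv_le`) bounds it from below by a quantity tending to `0`
(`IsBernstein.intervalIntegral_powExpDerivTwo_mul_le`). Hence `(-1)ⁿ f⁽ⁿ⁾ ≤ 0` for `n ≥ 1`, that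
is, `f` is a Bernstein function. No representing measure for `f` or `g` is needed.

The second fact, `IsBernstein.isCompletelyMonotone_rpow_neg`, is an induction on the order of the
derivative. Positivity holds because a non-negative integrand whose integral vanishes is zero
almost everywhere (`IsCompleteBernstein.pos`).
-/

open ProbabilityTheory Filter Topology

/-! ### Bernstein functions -/

section Bernstein

variable {g : ℝ → ℝ}

lemma IsBernstein.differentiableAt (hg : IsBernstein g) {t : ℝ} (ht : 0 < t) :
    DifferentiableAt ℝ g t :=
  hg.2.1.differentiableAt (Ioi_mem_nhds ht)

lemma IsBernstein.deriv_nonneg (hg : IsBernstein g) {t : ℝ} (ht : 0 < t) : 0 ≤ deriv g t := by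
  simpa using hg.2.2.2 0 t ht

lemma IsBernstein.hasDerivAt_deriv (hg : IsBernstein g) {t : ℝ} (ht : 0 < t) :
    HasDerivAt (deriv g) (deriv (deriv g) t) t :=
  ((hg.2.2.1.contDiffAt (Ioi_mem_nhds ht)).differentiableAt (by simp)).hasDerivAt

lemma IsBernstein.deriv_deriv_nonpos (hg : IsBernstein g) {t : ℝ} (ht : 0 < t) :
    deriv (deriv g) t ≤ 0 := by
  have := hg.2.2.2 1 t ht
  simp only [pow_one, iteratedDeriv_one] at this
  linarith

lemma IsBernstein.monotoneOn (hg : IsBernstein g) : MonotoneOn g (Ioi 0) := by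
  refine monotoneOn_of_deriv_nonneg (convex_Ioi 0) hg.2.1.continuousOn ?_ ?_ <;>
    rw [interior_Ioi]
  · exact hg.2.1
  · exact fun t ht => hg.deriv_nonneg ht

lemma IsBernstein.concaveOn (hg : IsBernstein g) : ConcaveOn ℝ (Ioi 0) g := by
  refine AntitoneOn.concaveOn_of_deriv (convex_Ioi 0) hg.2.1.continuousOn ?_ ?_ <;>
    rw [interior_Ioi]
  · exact hg.2.1
  refine antitoneOn_of_deriv_nonpos (convex_Ioi 0) hg.2.2.1.continuousOn ?_ ?_ <;>
    rw [interior_Ioi]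
  · exact fun t ht => (hg.hasDerivAt_deriv ht).differentiableAt.differentiableWithinAt
  · exact fun t ht => hg.deriv_deriv_nonpos ht

/-- A tangent line of a non-negative concave function on `]0, ∞[` is non-negative at the
origin. -/
lemma IsBernstein.mul_deriv_le (hg : IsBernstein g) {t : ℝ} (ht : 0 < t) :
    t * deriv g t ≤ g t := by
  have hlim : Tendsto (fun s : ℝ => (t - s) * deriv g t) (𝓝[>] 0) (𝓝 (t * deriv g t)) := by
    have : Continuous fun s : ℝ => (t - s) * deriv g t := by fun_prop
    simpa using (this.tendsto 0).mono_left nhdsWithin_le_nhds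
  refine le_of_tendsto hlim ?_
  filter_upwards [Ioo_mem_nhdsGT ht] with s hs
  have h := hg.concaveOn.deriv_le_slope hs.1 ht hs.2 (hg.differentiableAt ht)
  rw [slope_def_field, le_div_iff₀ (sub_pos.2 hs.2)] at h
  linarith [hg.1 s hs.1]

lemma IsBernstein.le_mul_one_add (hg : IsBernstein g) {t : ℝ} (ht : 0 < t) :
    g t ≤ g 1 * (1 + t) := by
  have h1 := hg.1 1 one_pos
  have hd := hg.mul_deriv_le one_pos
  rcases le_or_gt t 1 with h | h
  · nlinarith [hg.monotoneOn ht (mem_Ioi.2 one_pos) h]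
  · have hs := hg.concaveOn.slope_le_deriv (mem_Ioi.2 one_pos) ht h (hg.differentiableAt one_pos)
    rw [slope_def_field, div_le_iff₀ (sub_pos.2 h)] at hs
    nlinarith

lemma IsBernstein.aemeasurable (hg : IsBernstein g) :
    AEMeasurable g (volume.restrict (Ioi 0)) :=
  hg.2.1.continuousOn.aemeasurable measurableSet_Ioi

lemma IsBernstein.integrableOn_exp_mul (hg : IsBernstein g) {y : ℝ} (hy : 0 < y) :
    IntegrableOn (fun t => Real.exp (-(y * t)) * g t) (Ioi 0) := by
  have hb : IntegrableOn (fun t => g 1 * (1 + 2 / y) * Real.exp (-(y / 2) * t)) (Ioi 0) :=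
    (exp_neg_integrableOn_Ioi 0 (half_pos hy)).const_mul _
  refine hb.mono' (by have := hg.aemeasurable; fun_prop) ?_
  refine (ae_restrict_mem measurableSet_Ioi).mono fun t ht => ?_
  have ht : 0 < t := ht
  rw [Real.norm_of_nonneg (mul_nonneg (Real.exp_pos _).le (hg.1 t ht))]
  have hsplit : Real.exp (-(y * t)) = Real.exp (-(y / 2) * t) * Real.exp (-(y / 2) * t) := by
    rw [← Real.exp_add]; ring_nf
  have hinv : Real.exp (-(y / 2) * t) * Real.exp (y / 2 * t) = 1 := by
    rw [← Real.exp_add]; simp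
  -- the linear growth of `g` costs half of the exponential decay
  have hlin : 1 + t ≤ (1 + 2 / y) * Real.exp (y / 2 * t) := by
    have h1 := Real.add_one_le_exp (y / 2 * t)
    have h2 : t = 2 / y * (y / 2 * t) := by field_simp
    have h3 : 0 ≤ y / 2 * t := by positivity
    calc 1 + t = 1 + 2 / y * (y / 2 * t) := by rw [← h2]
      _ ≤ (1 + 2 / y) * (y / 2 * t + 1) := by
        have : 0 < 2 / y := by positivity
        nlinarith
      _ ≤ _ := by gcongr
  have hE := Real.exp_pos (-(y / 2) * t)
  calc Real.exp (-(y * t)) * g t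
      ≤ Real.exp (-(y * t)) * (g 1 * ((1 + 2 / y) * Real.exp (y / 2 * t))) := by
        gcongr
        exact (hg.le_mul_one_add ht).trans (mul_le_mul_of_nonneg_left hlin (hg.1 1 one_pos))
    _ = g 1 * (1 + 2 / y) * Real.exp (-(y / 2) * t) *
          (Real.exp (-(y / 2) * t) * Real.exp (y / 2 * t)) := by rw [hsplit]; ring
    _ = _ := by rw [hinv, mul_one]

end Bernstein

/-! ### Laplace moments -/

section Moments

variable {g : ℝ → ℝ}

/-- The `n`-th Laplace moment `∫₀^∞ tⁿ e^{-y t} g(t) dt`, which is `(-1)ⁿ` times the `n`-th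
derivative of the Laplace transform of `g` at `y`. -/
noncomputable def laplaceMoment (g : ℝ → ℝ) (n : ℕ) (y : ℝ) : ℝ :=
  ∫ t in Ioi (0 : ℝ), t ^ n * Real.exp (-(y * t)) * g t

/-- The measure `g(t) dt` on `]0, ∞[`; its moment generating function is the Laplace transform of
`g` up to the sign of the argument. -/
noncomputable def laplaceMeasure (g : ℝ → ℝ) : Measure ℝ :=
  (volume.restrict (Ioi 0)).withDensity fun t => ENNReal.ofReal (g t)

lemma laplaceMoment_zero (g : ℝ → ℝ) : laplaceMoment g 0 = laplaceReal g := by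
  ext y; simp [laplaceMoment, laplaceReal]

lemma IsBernstein.integral_laplaceMeasure (hg : IsBernstein g) (f : ℝ → ℝ) :
    ∫ t, f t ∂(laplaceMeasure g) = ∫ t in Ioi (0 : ℝ), f t * g t := by
  rw [laplaceMeasure, integral_withDensity_eq_integral_toReal_smul₀
    hg.aemeasurable.ennreal_ofReal (by simp)]
  refine setIntegral_congr_fun measurableSet_Ioi fun t ht => ?_
  simp [ENNReal.toReal_ofReal (hg.1 t ht), mul_comm]

lemma IsBernstein.integrable_laplaceMeasure (hg : IsBernstein g) (f : ℝ → ℝ) :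
    Integrable f (laplaceMeasure g) ↔ IntegrableOn (fun t => f t * g t) (Ioi 0) := by
  rw [laplaceMeasure, integrable_withDensity_iff_integrable_smul₀'
    hg.aemeasurable.ennreal_ofReal (by simp)]
  refine integrableOn_congr_fun (fun t ht => ?_) measurableSet_Ioi
  simp [ENNReal.toReal_ofReal (hg.1 t ht), mul_comm]

lemma IsBernstein.mem_interior_integrableExpSet (hg : IsBernstein g) {y : ℝ} (hy : 0 < y) :
    y ∈ interior (integrableExpSet (fun t : ℝ => -t) (laplaceMeasure g)) := by
  refine mem_interior.2 ⟨Ioi 0, fun z hz => ?_, isOpen_Ioi, hy⟩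
  refine (hg.integrable_laplaceMeasure _).2 ?_
  simpa using hg.integrableOn_exp_mul hz

lemma IsBernstein.integrableOn_pow_mul_exp_mul (hg : IsBernstein g) (n : ℕ) {y : ℝ}
    (hy : 0 < y) : IntegrableOn (fun t => t ^ n * Real.exp (-(y * t)) * g t) (Ioi 0) := by
  have h := integrable_pow_mul_exp_of_mem_interior_integrableExpSet
    (hg.mem_interior_integrableExpSet hy) n
  refine (((hg.integrable_laplaceMeasure _).1 h).const_mul ((-1) ^ n)).congr ?_
  refine Eventually.of_forall fun t => ?_
  simp only [neg_pow t n, mul_neg]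
  rw [← mul_assoc, ← mul_assoc, ← mul_assoc, ← mul_pow]
  simp

lemma IsBernstein.integral_neg_pow_mul_exp (hg : IsBernstein g) (n : ℕ) (y : ℝ) :
    ∫ t, (-t) ^ n * Real.exp (y * -t) ∂(laplaceMeasure g) =
      (-1) ^ n * laplaceMoment g n y := by
  rw [hg.integral_laplaceMeasure, laplaceMoment, ← integral_const_mul]
  congr 1 with t
  rw [neg_pow, mul_neg]
  ring

lemma IsBernstein.hasDerivAt_laplaceMoment (hg : IsBernstein g) (n : ℕ) {y : ℝ} (hy : 0 < y) :
    HasDerivAt (laplaceMoment g n) (-laplaceMoment g (n + 1) y) y := by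
  have h := (hasDerivAt_integral_pow_mul_exp_real
    (hg.mem_interior_integrableExpSet hy) n).const_mul ((-1) ^ n)
  simp only [hg.integral_neg_pow_mul_exp] at h
  simpa [pow_succ, ← mul_assoc, ← mul_pow] using h

lemma IsBernstein.contDiffOn_laplaceReal (hg : IsBernstein g) :
    ContDiffOn ℝ ∞ (laplaceReal g) (Ioi 0) := by
  have h : AnalyticOn ℝ (mgf (fun t : ℝ => -t) (laplaceMeasure g)) (Ioi 0) :=
    analyticOn_mgf.mono fun y hy => hg.mem_interior_integrableExpSet hy
  refine (h.contDiffOn (uniqueDiffOn_Ioi 0)).congr fun y _ => ?_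
  simpa [mgf, laplaceMoment_zero] using (hg.integral_neg_pow_mul_exp 0 y).symm

end Moments

/-! ### Complete Bernstein functions are Bernstein functions -/

section CompleteBernstein

variable {g : ℝ → ℝ}

/-- The second derivative of `t ↦ t ^ (m + 1) * exp (-(y * t))`. -/
noncomputable def powExpDerivTwo (m : ℕ) (y t : ℝ) : ℝ :=
  (y ^ 2 * t ^ (m + 1) - 2 * (m + 1) * y * t ^ m + (m + 1) * m * t ^ (m - 1)) *
    Real.exp (-(y * t))

lemma hasDerivAt_exp_neg_mul (y t : ℝ) :
    HasDerivAt (fun t => Real.exp (-(y * t))) (-y * Real.exp (-(y * t))) t := by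
  have := ((hasDerivAt_id t).const_mul y).neg.exp
  simpa [mul_comm] using this

lemma IsBernstein.integrableOn_powExpDerivTwo_mul (hg : IsBernstein g) (m : ℕ) {y : ℝ}
    (hy : 0 < y) : IntegrableOn (fun t => powExpDerivTwo m y t * g t) (Ioi 0) := by
  have h := (((hg.integrableOn_pow_mul_exp_mul (m + 1) hy).const_mul (y ^ 2)).sub
    ((hg.integrableOn_pow_mul_exp_mul m hy).const_mul (2 * (m + 1) * y))).add
    ((hg.integrableOn_pow_mul_exp_mul (m - 1) hy).const_mul ((m + 1) * m))
  refine h.congr (Eventually.of_forall fun t => ?_)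
  simp only [powExpDerivTwo, Pi.add_apply, Pi.sub_apply]
  ring

lemma IsBernstein.integral_powExpDerivTwo_mul (hg : IsBernstein g) (m : ℕ) {y : ℝ}
    (hy : 0 < y) :
    ∫ t in Ioi (0 : ℝ), powExpDerivTwo m y t * g t =
      y ^ 2 * laplaceMoment g (m + 1) y - 2 * (m + 1) * y * laplaceMoment g m y +
        (m + 1) * m * laplaceMoment g (m - 1) y := by
  have h1 := (hg.integrableOn_pow_mul_exp_mul (m + 1) hy).const_mul (y ^ 2)
  have h2 := (hg.integrableOn_pow_mul_exp_mul m hy).const_mul (2 * (m + 1) * y)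
  have h3 := (hg.integrableOn_pow_mul_exp_mul (m - 1) hy).const_mul ((m + 1) * m)
  simp only [laplaceMoment, ← integral_const_mul]
  rw [← integral_sub h1 h2]
  refine Eq.trans ?_ (integral_add (h1.sub h2) h3)
  congr 1 with t
  simp only [powExpDerivTwo]
  ring

/-- For `n ≥ 1`, differentiating `y² e^{-y t}` `n` times in `y` gives, up to the sign `(-1)ⁿ`, the
second derivative in `t` of `tⁿ e^{-y t}`. -/
lemma IsBernstein.iteratedDeriv_sq_mul_laplaceReal (hg : IsBernstein g) (m : ℕ) {y : ℝ}
    (hy : 0 < y) :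
    iteratedDeriv (m + 1) (fun y => y ^ 2 * laplaceReal g y) y =
      (-1) ^ (m + 1) * ∫ t in Ioi (0 : ℝ), powExpDerivTwo m y t * g t := by
  rw [hg.integral_powExpDerivTwo_mul m hy]
  induction m generalizing y with
  | zero =>
    have h := (hasDerivAt_pow 2 y).mul (hg.hasDerivAt_laplaceMoment 0 hy)
    rw [laplaceMoment_zero] at h
    rw [zero_add, iteratedDeriv_one]
    refine h.deriv.trans ?_
    simp [laplaceMoment_zero]
    ring
  | succ m ih =>
    rw [iteratedDeriv_succ]
    have hev : iteratedDeriv (m + 1) (fun y => y ^ 2 * laplaceReal g y) =ᶠ[𝓝 y] fun y =>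
        (-1) ^ (m + 1) * (y ^ 2 * laplaceMoment g (m + 1) y -
          2 * (m + 1) * y * laplaceMoment g m y + (m + 1) * m * laplaceMoment g (m - 1) y) := by
      filter_upwards [Ioi_mem_nhds hy] with z hz using ih hz
    rw [hev.deriv_eq]
    have h1 := (hasDerivAt_pow 2 y).mul (hg.hasDerivAt_laplaceMoment (m + 1) hy)
    have h2 := ((hasDerivAt_id y).const_mul (2 * ((m : ℝ) + 1))).mul
      (hg.hasDerivAt_laplaceMoment m hy)
    -- the coefficient `m` absorbs the truncated subtraction at `m = 0`
    have h3 : HasDerivAt (fun y => ((m : ℝ) + 1) * m * laplaceMoment g (m - 1) y)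
        (((m : ℝ) + 1) * m * -laplaceMoment g m y) y := by
      cases m with
      | zero => simpa using hasDerivAt_const y (0 : ℝ)
      | succ k => exact (hg.hasDerivAt_laplaceMoment k hy).const_mul _
    refine (((h1.sub h2).add h3).const_mul ((-1) ^ (m + 1))).deriv.trans ?_
    simp only [id, Nat.add_sub_cancel]
    push_cast
    ring

/-- Green's formula on `[a, b]` for `φ(t) = t ^ (m + 1) e^{-y t}` and a concave `g`, with the
boundary terms estimated. -/
lemma IsBernstein.intervalIntegral_powExpDerivTwo_mul_le (hg : IsBernstein g) (m : ℕ) {y a b : ℝ}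
    (hy : 0 < y) (ha : 0 < a) (ha1 : a ≤ 1) (hab : a ≤ b) (hb : m + 1 ≤ y * b) :
    ∫ t in a..b, powExpDerivTwo m y t * g t ≤ y * a * g 1 := by
  -- `F = φ' g - φ g'`, whose derivative is `φ'' g - φ g'' ≥ φ'' g`
  set F : ℝ → ℝ := fun t => (((m + 1) * t ^ m - y * t ^ (m + 1)) * Real.exp (-(y * t))) * g t -
    (t ^ (m + 1) * Real.exp (-(y * t))) * deriv g t with hF
  have hderiv : ∀ t, 0 < t → HasDerivAt F (powExpDerivTwo m y t * g t -
      (t ^ (m + 1) * Real.exp (-(y * t))) * deriv (deriv g) t) t := by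
    intro t ht
    have hp1 := hasDerivAt_pow (m + 1) t
    have hp := (((hasDerivAt_pow m t).const_mul ((m : ℝ) + 1)).sub (hp1.const_mul y)).mul
      (hasDerivAt_exp_neg_mul y t)
    have h := (hp.mul (hg.differentiableAt ht).hasDerivAt).sub
      ((hp1.mul (hasDerivAt_exp_neg_mul y t)).mul (hg.hasDerivAt_deriv ht))
    refine h.congr_deriv ?_
    simp only [powExpDerivTwo, Nat.add_sub_cancel, Pi.sub_apply, Pi.mul_apply]
    push_cast
    ring
  have hsub : Icc a b ⊆ Ioi 0 := fun t ht => ha.trans_le ht.1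
  have hint := intervalIntegral.integral_le_sub_of_hasDeriv_right_of_le hab
    (fun t ht => (hderiv t (hsub ht)).continuousAt.continuousWithinAt)
    (fun t ht => (hderiv t (hsub (Ioo_subset_Icc_self ht))).hasDerivWithinAt)
    ((hg.integrableOn_powExpDerivTwo_mul m hy).mono_set hsub)
    (fun t ht => by
      have ht0 : 0 < t := hsub (Ioo_subset_Icc_self ht)
      have h : 0 ≤ t ^ (m + 1) * Real.exp (-(y * t)) := by positivity
      nlinarith [mul_nonneg h (neg_nonneg.2 (hg.deriv_deriv_nonpos ht0))])
  have hfac : ∀ t, F t = t ^ m * Real.exp (-(y * t)) *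
      ((m + 1 - y * t) * g t - t * deriv g t) := fun t => by simp only [hF]; ring
  have hFb : F b ≤ 0 := by
    have hb0 : 0 < b := ha.trans_le hab
    rw [hfac]
    refine mul_nonpos_of_nonneg_of_nonpos (by positivity) ?_
    nlinarith [mul_nonneg (sub_nonneg.2 hb) (hg.1 b hb0), mul_nonneg hb0.le (hg.deriv_nonneg hb0)]
  have hFa : -(y * a * g 1) ≤ F a := by
    have hga := hg.1 a ha
    have hw0 : 0 ≤ a ^ m * Real.exp (-(y * a)) := by positivity
    have hw1 : a ^ m * Real.exp (-(y * a)) ≤ 1 :=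
      mul_le_one₀ (pow_le_one₀ ha.le ha1) (Real.exp_pos _).le
        (Real.exp_le_one_iff.2 (by nlinarith))
    have hmono := hg.monotoneOn ha (mem_Ioi.2 one_pos) ha1
    have hya : 0 ≤ y * a := by positivity
    have hbr : -(y * a * g a) ≤ (m + 1 - y * a) * g a - a * deriv g a := by
      nlinarith [hg.mul_deriv_le ha, mul_nonneg (Nat.cast_nonneg (α := ℝ) m) hga]
    rw [hfac]
    calc -(y * a * g 1) ≤ -(y * a * g a) := by
          have := mul_le_mul_of_nonneg_left hmono hya; linarith
      _ ≤ a ^ m * Real.exp (-(y * a)) * -(y * a * g a) := by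
          nlinarith [mul_nonneg hya hga]
      _ ≤ _ := mul_le_mul_of_nonneg_left hbr hw0
  linarith

lemma IsBernstein.integral_powExpDerivTwo_mul_nonpos (hg : IsBernstein g) (m : ℕ) {y : ℝ}
    (hy : 0 < y) : ∫ t in Ioi (0 : ℝ), powExpDerivTwo m y t * g t ≤ 0 := by
  set a : ℕ → ℝ := fun k => 1 / ((k : ℝ) + 1)
  have ha : Tendsto a atTop (𝓝 0) := tendsto_one_div_add_atTop_nhds_zero_nat
  have hb : Tendsto (fun k : ℕ => (k : ℝ)) atTop atTop := tendsto_natCast_atTop_atTop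
  have hcover : AECover (volume.restrict (Ioi (0 : ℝ))) atTop fun k : ℕ => Ioc (a k) (k : ℝ) :=
    (aecover_Ioi_of_Ioi ha).inter (aecover_Iic hb)
  have hlim := hcover.integral_tendsto_of_countably_generated
    (hg.integrableOn_powExpDerivTwo_mul m hy)
  have hbound : Tendsto (fun k => y * a k * g 1) atTop (𝓝 0) := by
    simpa using (ha.const_mul y).mul_const (g 1)
  refine le_of_tendsto_of_tendsto hlim hbound ?_
  filter_upwards [hb.eventually_ge_atTop ((m + 1) / y), hb.eventually_ge_atTop 1] with k hk hk1
  have hak : 0 < a k := by positivity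
  have hak1 : a k ≤ 1 := by
    rw [div_le_one (by positivity)]; linarith
  have hsub : Ioc (a k) (k : ℝ) ⊆ Ioi 0 := fun t ht => hak.trans ht.1
  rw [Measure.restrict_restrict measurableSet_Ioc,
    inter_eq_left.2 hsub,
    ← intervalIntegral.integral_of_le (hak1.trans hk1)]
  refine hg.intervalIntegral_powExpDerivTwo_mul_le m hy hak hak1 (hak1.trans hk1) ?_
  rw [div_le_iff₀ hy] at hk
  linarith

lemma IsBernstein.congr {f h : ℝ → ℝ} (hf : IsBernstein f) (hfh : EqOn h f (Ioi 0)) :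
    IsBernstein h := by
  have hd : EqOn (deriv h) (deriv f) (Ioi 0) := fun y hy =>
    (hfh.eventuallyEq_of_mem (Ioi_mem_nhds hy)).deriv_eq
  refine ⟨fun y hy => hfh hy ▸ hf.1 y hy, hf.2.1.congr hfh, hf.2.2.1.congr hd,
    fun n y hy => ?_⟩
  rw [(hd.eventuallyEq_of_mem (Ioi_mem_nhds hy)).iteratedDeriv_eq n]
  exact hf.2.2.2 n y hy

theorem IsBernstein.sq_mul_laplaceReal (hg : IsBernstein g) :
    IsBernstein fun y => y ^ 2 * laplaceReal g y := by
  have hsmooth : ContDiffOn ℝ ∞ (fun y => y ^ 2 * laplaceReal g y) (Ioi 0) :=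
    (contDiff_id.pow 2).contDiffOn.mul hg.contDiffOn_laplaceReal
  refine ⟨fun y _ => mul_nonneg (sq_nonneg y) ?_, hsmooth.differentiableOn (by simp),
    ((contDiffOn_infty_iff_deriv_of_isOpen isOpen_Ioi).1 hsmooth).2, fun n y hy => ?_⟩
  · exact setIntegral_nonneg measurableSet_Ioi fun t ht =>
      mul_nonneg (Real.exp_pos _).le (hg.1 t ht)
  · rw [← iteratedDeriv_succ', hg.iteratedDeriv_sq_mul_laplaceReal n hy, ← mul_assoc, ← pow_add,
      Odd.neg_one_pow ⟨n, by ring⟩]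
    linarith [hg.integral_powExpDerivTwo_mul_nonpos n hy]

theorem IsCompleteBernstein.isBernstein {f : ℝ → ℝ} (hf : IsCompleteBernstein f) :
    IsBernstein f := by
  obtain ⟨g, hg, hfg⟩ := hf
  exact hg.sq_mul_laplaceReal.congr fun y hy => hfg y hy

/-- If `f(p) = 0` for one `p`, then `g` vanishes almost everywhere and `f` vanishes identically. -/
theorem IsCompleteBernstein.pos {f : ℝ → ℝ} (hf : IsCompleteBernstein f)
    (hf0 : ∃ p : ℝ, 0 < p ∧ f p ≠ 0) {p : ℝ} (hp : 0 < p) : 0 < f p := by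
  refine (hf.isBernstein.1 p hp).lt_of_ne' fun hzero => ?_
  obtain ⟨g, hg, hfg⟩ := hf
  obtain ⟨q, hq, hfq⟩ := hf0
  rw [hfg p hp, mul_eq_zero, or_iff_right (pow_ne_zero 2 hp.ne'), laplaceReal,
    setIntegral_eq_zero_iff_of_nonneg_ae ((ae_restrict_mem measurableSet_Ioi).mono fun t ht =>
      mul_nonneg (Real.exp_pos _).le (hg.1 t ht)) (hg.integrableOn_exp_mul hp)] at hzero
  refine hfq ?_
  rw [hfg q hq, laplaceReal, integral_eq_zero_of_ae, mul_zero]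
  filter_upwards [hzero] with t ht
  have : g t = 0 := by simpa [(Real.exp_pos _).ne'] using ht
  simp [this]

end CompleteBernstein

/-! ### Negative powers of Bernstein functions -/

lemma IsBernstein.contDiffOn {f : ℝ → ℝ} (hf : IsBernstein f) : ContDiffOn ℝ ∞ f (Ioi 0) :=
  (contDiffOn_infty_iff_deriv_of_isOpen isOpen_Ioi).2 ⟨hf.2.1, hf.2.2.1⟩

lemma IsBernstein.contDiffOn_rpow {f : ℝ → ℝ} (hf : IsBernstein f)
    (hpos : ∀ y, 0 < y → 0 < f y) (β : ℝ) : ContDiffOn ℝ ∞ (fun y => f y ^ β) (Ioi 0) :=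
  hf.contDiffOn.rpow_const_of_ne fun y hy => (hpos y hy).ne'

/-- Induction on the order of the derivative, for all exponents at once: the derivative of
`f ^ (-α)` is `-α` times the product of `f ^ (-(α + 1))` and the completely monotone `f'`, to which
the Leibniz rule applies. -/
theorem IsBernstein.isCompletelyMonotone_rpow_neg {f : ℝ → ℝ} (hf : IsBernstein f)
    (hpos : ∀ y, 0 < y → 0 < f y) {α : ℝ} (hα : 0 ≤ α) :
    IsCompletelyMonotone fun y => f y ^ (-α) := by
  refine ⟨hf.contDiffOn_rpow hpos _, fun n => ?_⟩
  induction n using Nat.strong_induction_on generalizing α with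
  | _ n ih =>
    intro y hy
    cases n with
    | zero => simpa using (Real.rpow_pos_of_pos (hpos y hy) _).le
    | succ n =>
      have hev : deriv (fun y => f y ^ (-α)) =ᶠ[𝓝 y]
          fun y => -α * ((fun y => f y ^ (-(α + 1))) * deriv f) y := by
        filter_upwards [Ioi_mem_nhds hy] with z hz
        rw [((hf.differentiableAt hz).hasDerivAt.rpow_const (Or.inl (hpos z hz).ne')).deriv,
          Pi.mul_apply, neg_add']
        ring
      rw [iteratedDeriv_succ', hev.iteratedDeriv_eq, iteratedDeriv_const_mul_field,
        iteratedDeriv_mul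
          (((hf.contDiffOn_rpow hpos _).contDiffAt (Ioi_mem_nhds hy)).of_le
            (by exact_mod_cast le_top))
          ((hf.2.2.1.contDiffAt (Ioi_mem_nhds hy)).of_le (by exact_mod_cast le_top))]
      have hsum : 0 ≤ ∑ i ∈ Finset.range (n + 1), (n.choose i : ℝ) *
          ((-1) ^ i * iteratedDeriv i (fun y => f y ^ (-(α + 1))) y) *
            ((-1) ^ (n - i) * iteratedDeriv (n - i) (deriv f) y) := by
        refine Finset.sum_nonneg fun i hi => ?_
        have h1 := ih i (Finset.mem_range.1 hi) (α := α + 1) (by positivity) y hy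
        have h2 := hf.2.2.2 (n - i) y hy
        positivity
      refine (mul_nonneg hα hsum).trans_eq ?_
      rw [pow_succ, Finset.mul_sum, Finset.mul_sum, Finset.mul_sum]
      refine Finset.sum_congr rfl fun i hi => ?_
      have hpow : (-1 : ℝ) ^ n = (-1) ^ i * (-1) ^ (n - i) := by
        rw [← pow_add, Nat.add_sub_cancel' (Nat.lt_succ_iff.1 (Finset.mem_range.1 hi))]
      rw [hpow]
      ring

theorem mainTheorem5 (Q : ℝ → ℝ) (hQ : IsCompleteBernstein Q)
    (hQ0 : ∃ p : ℝ, 0 < p ∧ Q p ≠ 0) (α : ℝ) (hα : 0 < α) :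
    (∀ p : ℝ, 0 < p → 0 < Q p) ∧ IsCompletelyMonotone (fun p => Q p ^ (-α)) :=
  ⟨fun _ hp => hQ.pos hQ0 hp,
    hQ.isBernstein.isCompletelyMonotone_rpow_neg (fun _ hp => hQ.pos hQ0 hp) hα.le⟩
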